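/- Let $\mathsf{At}$ be a set of atomic sentences and $\mathsf{Ag}$ a set of agents. A state model $\mathbf S$ consists of a set $S$ of states, a relation $\to_A\subseteq S\times S$ for each $A\in\mathsf{Ag}$, and a set $\|p\|_{\mathbf S}\subseteq S$ for each $p\in\mathsf{At}$. An epistemic proposition assigns to each state model a set of its states. A program model $(M,(\to_A)_{A},\mathrm{Pre},\Gamma)$ consists of a set $M$, relations $\to_A\subseteq M\times M$ for $A\in\mathsf{Ag}$, an epistemic proposition $\mathrm{Pre}(\sigma)$ for each $\sigma\in M$, and a set $\Gamma\subseteq M$. The state model $\mathbf S\otimes M$ has as states the pairs $(s,\sigma)\in S\times M$ with $s\in\mathrm{Pre}(\sigma)_{\mathbf S}$, with $(s,\sigma)\to_A(s',\sigma')$ iff $s\to_A s'$ and $\sigma\to_A\sigma'$, and with $(s,\sigma)\in\|p\|$ iff $s\in\|p\|_{\mathbf S}$. Let $\Sigma$ be an action signature: a finite set of action types, enumerated without repetitions as $\sigma_1,\dots,\sigma_n$, with a relation $\to_A$ on it for each $A\in\mathsf{Ag}$. The sentences $\varphi$ and programs $\pi$ of $\mathcal L_1(\Sigma)$ are given by $$\varphi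 ::= \mathsf{true}\mid p\mid\neg\varphi\mid\varphi\wedge\psi\mid\Box_A\varphi\mid\Box^*_B\varphi\mid[\pi]\varphi,\qquad \pi ::= \mathsf{skip}\mid\mathsf{crash}\mid\sigma_i\psi_1\cdots\psi_n\mid\pi\cup\rho\mid\pi;\rho,$$ where $p\in\mathsf{At}$, $A\in\mathsf{Ag}$ and $B$ is a finite set of agents. A sentence denotes an epistemic proposition and a program denotes a program model, by simultaneous recursion: $\mathsf{true}$, atomic sentences, $\neg$, $\wedge$ and $\Box_A$ are interpreted as usual in multi-agent Kripke models; $\Box^*_B\varphi$ holds at $s$ iff $\varphi$ holds at every state reachable from $s$ by a finite, possibly empty, sequence of arrows labelled by agents in $B$; and $[\pi]\varphi$ holds at $s$ in $\mathbf S$ iff, where $\pi$ denotes $(M,(\to_A)_A,\mathrm{Pre},\Gamma)$, $\varphi$ holds at $(s,\sigma)$ in $\mathbf S\otimes M$ for every $\sigma\in\Gamma$ with $s\in\mathrm{Pre}(\sigma)_{\mathbf S}$. The program $\mathsf{skip}$ denotes the one-action model with all arrows, the always true precondition, and its action designated; $\mathsf{crash}$ denotes the empty model; $\sigma_i\psi_1\cdots\psi_n$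 denotes $\Sigma$ with $\mathrm{Pre}(\sigma_j)$ the denotation of $\psi_j$ and $\Gamma=\{\sigma_i\}$; $\cup$ denotes the disjoint union of program models; and if $\pi,\rho$ denote $M,N$, then $\pi;\rho$ denotes the product $M\times N$ with componentwise arrows, with $\Gamma_M\times\Gamma_N$ as its set of designated actions, and with $s\in\mathrm{Pre}(\sigma,\delta)_{\mathbf S}$ iff $s\in\mathrm{Pre}_M(\sigma)_{\mathbf S}$ and $(s,\sigma)\in\mathrm{Pre}_N(\delta)_{\mathbf S\otimes M}$. Propositional dynamic logic (PDL) over the same $\mathsf{At}$, with the agents as atomic programs, has sentences and programs $$\varphi ::= \mathsf{true}\mid p\mid\neg\varphi\mid\varphi\wedge\psi\mid[\pi]\varphi,\qquad \pi ::= A\mid{?\varphi}\mid\pi;\rho\mid\pi\cup\rho\mid\pi^*,$$ interpreted in a state model in the standard way: $A$ denotes $\to_A$, $?\varphi$ denotes $\{(s,s): s\models\varphi\}$, and $;$, $\cup$, ${}^*$ denote relational composition, union, and reflexive-transitive closure. **Theorem.** For every action signature $\Sigma$, every sentence $\varphi$ of $\mathcal L_1(\Sigma)$ is equivalent to a sentence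 $\psi$ of PDL: for every state model $\mathbf S$ and every state $s$ of $\mathbf S$, $\varphi$ holds at $s$ in $\mathbf S$ if and only if $\psi$ holds at $s$ in $\mathbf S$. -/

import Mathlib

universe u a p

namespace DEL

/-- State models: multi-agent Kripke models. -/
structure StateModel (Agent : Type a) (AtSen : Type p) : Type (max (u + 1) a p) where
  State : Type u
  arrow : Agent → State → State → Prop
  val : AtSen → Set State

/-- Epistemic propositions: operations assigning to each state model a set of its states. -/
def EpProp (Agent : Type a) (AtSen : Type p) : Type (max (u + 1) a p) :=
  (S : StateModel.{u} Agent AtSen) → Set S.State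

namespace StateModel

variable {Agent : Type a} {AtSen : Type p}

/-- A finite, possibly empty, sequence of arrows labelled with agents from the group `B` leads
from one state to the other. -/
def reach (S : StateModel.{u} Agent AtSen) (B : Set Agent) : S.State → S.State → Prop :=
  Relation.ReflTransGen (fun s t => ∃ A ∈ B, S.arrow A s t)

end StateModel

/-- Updates: a map on state models together with a transition relation from each state model
to its image. -/
structure Update (Agent : Type a) (AtSen : Type p) : Type (max (u + 1) a p) where
  map : StateModel.{u} Agent AtSen → StateModel.{u} Agent AtSen
  rel : (S : StateModel.{u} Agent AtSen) → S.State → (map S).State → Prop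

namespace EpProp

variable {Agent : Type a} {AtSen : Type p}

def true : EpProp.{u} Agent AtSen := fun _ => Set.univ

def atom (q : AtSen) : EpProp.{u} Agent AtSen := fun S => S.val q

def neg (φ : EpProp.{u} Agent AtSen) : EpProp.{u} Agent AtSen := fun S => (φ S)ᶜ

def and (φ ψ : EpProp.{u} Agent AtSen) : EpProp.{u} Agent AtSen := fun S => φ S ∩ ψ S

/-- Knowledge: `□_A φ`. -/
def box (A : Agent) (φ : EpProp.{u} Agent AtSen) : EpProp.{u} Agent AtSen :=
  fun S => {s | ∀ t, S.arrow A s t → t ∈ φ S}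

/-- Common knowledge: `□*_B φ`. -/
def boxStar (B : Set Agent) (φ : EpProp.{u} Agent AtSen) : EpProp.{u} Agent AtSen :=
  fun S => {s | ∀ t, S.reach B s t → t ∈ φ S}

/-- The dynamic modality `[α] φ`. -/
def after (α : Update.{u} Agent AtSen) (φ : EpProp.{u} Agent AtSen) : EpProp.{u} Agent AtSen :=
  fun S => {s | ∀ t, α.rel S s t → t ∈ φ (α.map S)}

/-- The dual dynamic modality `⟨α⟩ φ`. -/
def canAfter (α : Update.{u} Agent AtSen) (φ : EpProp.{u} Agent AtSen) :
    EpProp.{u} Agent AtSen :=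
  fun S => {s | ∃ t, α.rel S s t ∧ t ∈ φ (α.map S)}

end EpProp

/-- Program models: an action model (simple actions, accessibility relations, preconditions)
with a set of designated simple actions. -/
structure ProgramModel (Agent : Type a) (AtSen : Type p) : Type (max (u + 1) a p) where
  Act : Type
  arrow : Agent → Act → Act → Prop
  pre : Act → EpProp.{u} Agent AtSen
  designated : Set Act

namespace ProgramModel

variable {Agent : Type a} {AtSen : Type p}

/-- The update product of a state model with the underlying action model. -/
def product (S : StateModel.{u} Agent AtSen) (M : ProgramModel.{u} Agent AtSen) :
    StateModel.{u} Agent AtSen where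
  State := {x : S.State × M.Act // x.1 ∈ M.pre x.2 S}
  arrow A x y := S.arrow A x.1.1 y.1.1 ∧ M.arrow A x.1.2 y.1.2
  val q := {x | x.1.1 ∈ S.val q}

/-- The update induced by a program model. -/
def toUpdate (M : ProgramModel.{u} Agent AtSen) : Update.{u} Agent AtSen where
  map S := product S M
  rel _ s x := s = x.1.1 ∧ x.1.2 ∈ M.designated

/-- The same action model with the single designated action `σ`. -/
def point (M : ProgramModel.{u} Agent AtSen) (σ : M.Act) : ProgramModel.{u} Agent AtSen where
  Act := M.Act
  arrow := M.arrow
  pre := M.pre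
  designated := {σ}

def skip : ProgramModel.{u} Agent AtSen where
  Act := Unit
  arrow _ _ _ := True
  pre _ := EpProp.true
  designated := Set.univ

def crash : ProgramModel.{u} Agent AtSen where
  Act := Empty
  arrow _ _ _ := False
  pre _ := EpProp.true
  designated := ∅

/-- Sequential composition. -/
def comp (M N : ProgramModel.{u} Agent AtSen) : ProgramModel.{u} Agent AtSen where
  Act := M.Act × N.Act
  arrow A x y := M.arrow A x.1 y.1 ∧ N.arrow A x.2 y.2
  pre x := EpProp.canAfter (M.point x.1).toUpdate (N.pre x.2)
  designated := M.designated ×ˢ N.designated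

/-- Disjoint union (non-deterministic choice). -/
def union (M N : ProgramModel.{u} Agent AtSen) : ProgramModel.{u} Agent AtSen where
  Act := M.Act ⊕ N.Act
  arrow A := Sum.LiftRel (M.arrow A) (N.arrow A)
  pre := Sum.elim M.pre N.pre
  designated := Sum.inl '' M.designated ∪ Sum.inr '' N.designated

end ProgramModel

/-- Action signatures: a finite Kripke frame of action types, enumerated without repetitions. -/
structure ActionSignature (Agent : Type a) where
  n : ℕ
  Act : Type
  arrow : Agent → Act → Act → Prop
  enum : Fin n ≃ Act

/-- The signature-based program model with designated action `σ`; the `j`-th action type has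
precondition `ψ j`. -/
def ActionSignature.programModel {Agent : Type a} {AtSen : Type p} (Sig : ActionSignature Agent)
    (σ : Sig.Act) (ψ : Fin Sig.n → EpProp.{u} Agent AtSen) : ProgramModel.{u} Agent AtSen where
  Act := Sig.Act
  arrow := Sig.arrow
  pre τ := ψ (Sig.enum.symm τ)
  designated := {σ}

mutual

/-- Sentences of `L₁(Σ)`. -/
inductive Sentence {Agent : Type a} (Sig : ActionSignature Agent) (AtSen : Type p) :
    Type (max a p)
  | true : Sentence Sig AtSen
  | atom : AtSen → Sentence Sig AtSen
  | neg : Sentence Sig AtSen → Sentence Sig AtSen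
  | and : Sentence Sig AtSen → Sentence Sig AtSen → Sentence Sig AtSen
  | box : Agent → Sentence Sig AtSen → Sentence Sig AtSen
  | boxStar : Finset Agent → Sentence Sig AtSen → Sentence Sig AtSen
  | after : Program Sig AtSen → Sentence Sig AtSen → Sentence Sig AtSen

/-- Programs of `L₁(Σ)`; `basic σ ψ` is the basic action `σ ψ₁ ⋯ ψₙ`. -/
inductive Program {Agent : Type a} (Sig : ActionSignature Agent) (AtSen : Type p) :
    Type (max a p)
  | skip : Program Sig AtSen
  | crash : Program Sig AtSen
  | basic : Sig.Act → (Fin Sig.n → Sentence Sig AtSen) → Program Sig AtSen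
  | union : Program Sig AtSen → Program Sig AtSen → Program Sig AtSen
  | comp : Program Sig AtSen → Program Sig AtSen → Program Sig AtSen

end

mutual

/-- The epistemic proposition denoted by a sentence of `L₁(Σ)`. -/
def Sentence.sem {Agent : Type a} {AtSen : Type p} {Sig : ActionSignature Agent} :
    Sentence Sig AtSen → EpProp.{u} Agent AtSen
  | .true => EpProp.true
  | .atom q => EpProp.atom q
  | .neg φ => φ.sem.neg
  | .and φ ψ => φ.sem.and ψ.sem
  | .box A φ => φ.sem.box A
  | .boxStar B φ => φ.sem.boxStar (B : Set Agent)
  | .after π φ => φ.sem.after π.sem.toUpdate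

/-- The program model denoted by a program of `L₁(Σ)`. -/
def Program.sem {Agent : Type a} {AtSen : Type p} {Sig : ActionSignature Agent} :
    Program Sig AtSen → ProgramModel.{u} Agent AtSen
  | .skip => ProgramModel.skip
  | .crash => ProgramModel.crash
  | .basic σ ψ => Sig.programModel σ (fun j => (ψ j).sem)
  | .union π ρ => π.sem.union ρ.sem
  | .comp π ρ => π.sem.comp ρ.sem

end

namespace PDL

mutual

/-- Sentences of propositional dynamic logic, with the agents as atomic programs. -/
inductive Sentence (Agent : Type a) (AtSen : Type p) : Type (max a p)
  | true : Sentence Agent AtSen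
  | atom : AtSen → Sentence Agent AtSen
  | neg : Sentence Agent AtSen → Sentence Agent AtSen
  | and : Sentence Agent AtSen → Sentence Agent AtSen → Sentence Agent AtSen
  | box : Program Agent AtSen → Sentence Agent AtSen → Sentence Agent AtSen

/-- Programs of propositional dynamic logic. -/
inductive Program (Agent : Type a) (AtSen : Type p) : Type (max a p)
  | atom : Agent → Program Agent AtSen
  | test : Sentence Agent AtSen → Program Agent AtSen
  | comp : Program Agent AtSen → Program Agent AtSen → Program Agent AtSen
  | union : Program Agent AtSen → Program Agent AtSen → Program Agent AtSen
  | star : Program Agent AtSen → Program Agent AtSen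

end

mutual

/-- The set of states of `S` at which a sentence of propositional dynamic logic holds. -/
def Sentence.sem {Agent : Type a} {AtSen : Type p} (S : StateModel.{u} Agent AtSen) :
    Sentence Agent AtSen → Set S.State
  | .true => Set.univ
  | .atom q => S.val q
  | .neg φ => (φ.sem S)ᶜ
  | .and φ ψ => φ.sem S ∩ ψ.sem S
  | .box π φ => {s | ∀ t, π.sem S s t → t ∈ φ.sem S}

/-- The transition relation on `S` denoted by a program of propositional dynamic logic. -/
def Program.sem {Agent : Type a} {AtSen : Type p} (S : StateModel.{u} Agent AtSen) :
    Program Agent AtSen → S.State → S.State → Prop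
  | .atom A => S.arrow A
  | .test φ => fun s t => s = t ∧ s ∈ φ.sem S
  | .comp π ρ => Relation.Comp (π.sem S) (ρ.sem S)
  | .union π ρ => fun s t => π.sem S s t ∨ ρ.sem S s t
  | .star π => Relation.ReflTransGen (π.sem S)

end

end PDL

end DEL

namespace DEL

variable {Agent : Type a} {AtSen : Type p}

-- Updating by a finite action model with definable preconditions can be simulated inside PDL. An
-- arrow path in the product `product S M` is a path in `S` together with a path of actions, so a
-- PDL program on the product becomes a matrix of PDL programs on `S`, indexed by pairs of actions
-- (`pullRel_program`). Composition becomes the matrix product, and iteration becomes Kleene's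
-- construction for finite automata (`transGen_matrix`). Simultaneously, `[M, σ]` is pushed through
-- PDL sentences (`afterAct_sentence`). The theorem then follows by mutual induction: sentences
-- denote definable propositions, programs denote finite models with definable preconditions.

/-- An epistemic proposition is definable in propositional dynamic logic. -/
def EpProp.IsPDL (P : EpProp.{u} Agent AtSen) : Prop :=
  ∃ ψ : PDL.Sentence Agent AtSen, ∀ S s, s ∈ P S ↔ s ∈ ψ.sem S

/-- A binary relation on every state model. -/
abbrev EpRel (Agent : Type a) (AtSen : Type p) : Type (max (u + 1) a p) :=
  (S : StateModel.{u} Agent AtSen) → S.State → S.State → Prop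

/-- A family of relations is definable by a program of propositional dynamic logic. -/
def EpRel.IsPDL (R : EpRel.{u} Agent AtSen) : Prop :=
  ∃ π : PDL.Program Agent AtSen, ∀ S s t, R S s t ↔ π.sem S s t

-- Closure properties of definable propositions and relations.

namespace EpProp.IsPDL

variable {P Q : EpProp.{u} Agent AtSen}

theorem true : (EpProp.true : EpProp.{u} Agent AtSen).IsPDL :=
  ⟨.true, fun _ _ => by simp [EpProp.true, PDL.Sentence.sem]⟩

theorem atom (q : AtSen) : (EpProp.atom q : EpProp.{u} Agent AtSen).IsPDL :=
  ⟨.atom q, fun _ _ => by simp [EpProp.atom, PDL.Sentence.sem]⟩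

theorem neg (hP : P.IsPDL) : P.neg.IsPDL := by
  obtain ⟨ψ, h⟩ := hP
  exact ⟨.neg ψ, fun S s => by simp [EpProp.neg, PDL.Sentence.sem, h]⟩

theorem and (hP : P.IsPDL) (hQ : Q.IsPDL) : (P.and Q).IsPDL := by
  obtain ⟨ψ, h⟩ := hP
  obtain ⟨χ, h'⟩ := hQ
  exact ⟨.and ψ χ, fun S s => by simp [EpProp.and, PDL.Sentence.sem, h, h']⟩

theorem boxRel {R : EpRel.{u} Agent AtSen} (hR : R.IsPDL) (hP : P.IsPDL) :
    EpProp.IsPDL (fun S => {s | ∀ t, R S s t → t ∈ P S}) := by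
  obtain ⟨π, h⟩ := hR
  obtain ⟨ψ, h'⟩ := hP
  exact ⟨.box π ψ, fun S s => by simp [PDL.Sentence.sem, h, h']⟩

theorem forall_finset {ι : Type*} {F : ι → EpProp.{u} Agent AtSen} (X : Finset ι)
    (hF : ∀ i, (F i).IsPDL) : EpProp.IsPDL (fun S => {s | ∀ i ∈ X, s ∈ F i S}) := by
  classical
  induction X using Finset.induction_on with
  | empty =>
    obtain ⟨ψ, h⟩ := EpProp.IsPDL.true (Agent := Agent) (AtSen := AtSen)
    exact ⟨ψ, fun S s => Iff.trans (by simp [EpProp.true]) (h S s)⟩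
  | insert k X _ ih =>
    obtain ⟨ψ, h⟩ := (hF k).and ih
    exact ⟨ψ, fun S s => by simp [← h, EpProp.and]⟩

end EpProp.IsPDL

namespace EpRel.IsPDL

variable {R T : EpRel.{u} Agent AtSen}

theorem atom (A : Agent) : EpRel.IsPDL (fun S : StateModel.{u} Agent AtSen => S.arrow A) :=
  ⟨.atom A, fun _ _ _ => by simp [PDL.Program.sem]⟩

theorem test {P : EpProp.{u} Agent AtSen} (hP : P.IsPDL) :
    EpRel.IsPDL (fun S s t => s = t ∧ s ∈ P S) := by
  obtain ⟨ψ, h⟩ := hP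
  exact ⟨.test ψ, fun S s t => by simp [PDL.Program.sem, h]⟩

theorem false : EpRel.IsPDL (fun (_ : StateModel.{u} Agent AtSen) _ _ => False) := by
  obtain ⟨π, h⟩ := test (EpProp.IsPDL.true (Agent := Agent) (AtSen := AtSen)).neg
  exact ⟨π, fun S s t => Iff.trans (by simp [EpProp.neg, EpProp.true]) (h S s t)⟩

theorem comp (hR : R.IsPDL) (hT : T.IsPDL) :
    EpRel.IsPDL (fun S s t => ∃ v, R S s v ∧ T S v t) := by
  obtain ⟨π, h⟩ := hR
  obtain ⟨ρ, h'⟩ := hT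
  exact ⟨.comp π ρ, fun S s t => by simp [PDL.Program.sem, Relation.Comp, h, h']⟩

theorem union (hR : R.IsPDL) (hT : T.IsPDL) :
    EpRel.IsPDL (fun S s t => R S s t ∨ T S s t) := by
  obtain ⟨π, h⟩ := hR
  obtain ⟨ρ, h'⟩ := hT
  exact ⟨.union π ρ, fun S s t => by simp [PDL.Program.sem, h, h']⟩

theorem star (hR : R.IsPDL) : EpRel.IsPDL (fun S => Relation.ReflTransGen (R S)) := by
  obtain ⟨π, h⟩ := hR
  refine ⟨.star π, fun S s t => ?_⟩
  have hS : R S = π.sem S := funext₂ fun s t => propext (h S s t)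
  simp only [hS, PDL.Program.sem]

theorem exists_finset {ι : Type*} {F : ι → EpRel.{u} Agent AtSen} (X : Finset ι)
    (hF : ∀ i, (F i).IsPDL) : EpRel.IsPDL (fun S s t => ∃ i ∈ X, F i S s t) := by
  classical
  induction X using Finset.induction_on with
  | empty =>
    obtain ⟨ψ, h⟩ := EpRel.IsPDL.false (Agent := Agent) (AtSen := AtSen)
    exact ⟨ψ, fun S s t => Iff.trans (by simp) (h S s t)⟩
  | insert k X _ ih =>
    obtain ⟨ψ, h⟩ := (hF k).union ih
    exact ⟨ψ, fun S s t => by simp [← h]⟩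

/-- Since `c` does not depend on the state model, it is decided outside the logic. It serves for
conditions on actions alone, such as `M.arrow A σ τ` or `σ = τ`. -/
theorem const_and (c : Prop) (hR : R.IsPDL) : EpRel.IsPDL (fun S s t => c ∧ R S s t) := by
  by_cases hc : c
  · simpa [hc] using hR
  · simpa [hc] using EpRel.IsPDL.false (Agent := Agent) (AtSen := AtSen)

/-- Restricting the source and the target of a relation. -/
theorem restrict {P Q : EpProp.{u} Agent AtSen} (hP : P.IsPDL) (hQ : Q.IsPDL) (hR : R.IsPDL) :
    EpRel.IsPDL (fun S s t => s ∈ P S ∧ t ∈ Q S ∧ R S s t) := by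
  obtain ⟨π, h⟩ := (test hP).comp (hR.comp (test hQ))
  refine ⟨π, fun S s t => ?_⟩
  rw [← h]
  constructor
  · rintro ⟨hs, ht, hst⟩
    exact ⟨s, ⟨rfl, hs⟩, t, hst, rfl, ht⟩
  · rintro ⟨_, ⟨rfl, hs⟩, _, hst, rfl, ht⟩
    exact ⟨hs, ht, hst⟩

end EpRel.IsPDL

theorem EpProp.IsPDL.box {P : EpProp.{u} Agent AtSen} (A : Agent) (hP : P.IsPDL) :
    (P.box A).IsPDL :=
  boxRel (EpRel.IsPDL.atom A) hP

theorem EpProp.IsPDL.boxStar {P : EpProp.{u} Agent AtSen} (B : Finset Agent) (hP : P.IsPDL) :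
    (P.boxStar (B : Set Agent)).IsPDL :=
  boxRel (EpRel.IsPDL.exists_finset B EpRel.IsPDL.atom).star hP

-- Kleene's theorem for matrices of relations.

/-- Nonempty paths of `r` in a labelled graph all of whose intermediate nodes have labels
in `X`. -/
inductive PathVia {V I : Type*} (r : V × I → V × I → Prop) (X : Set I) :
    V × I → V × I → Prop
  | single {x y} : r x y → PathVia r X x y
  | cons {x y z} : r x y → y.2 ∈ X → PathVia r X y z → PathVia r X x z

namespace PathVia

variable {V I : Type*} {r : V × I → V × I → Prop} {X Y : Set I} {x y z : V × I}

theorem trans (h : PathVia r X x y) (hy : y.2 ∈ X) (h' : PathVia r X y z) :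
    PathVia r X x z := by
  induction h with
  | single h => exact .cons h hy h'
  | cons h hX _ ih => exact .cons h hX (ih hy h')

theorem mono (hXY : X ⊆ Y) (h : PathVia r X x y) : PathVia r Y x y := by
  induction h with
  | single h => exact .single h
  | cons h hX _ ih => exact .cons h (hXY hX) ih

theorem empty_iff : PathVia r ∅ x y ↔ r x y := by
  refine ⟨fun h => ?_, .single⟩
  cases h with
  | single h => exact h
  | cons _ h => exact h.elim

theorem univ_iff : PathVia r Set.univ x y ↔ Relation.TransGen r x y := by
  constructor
  · intro h
    induction h with
    | single h => exact .single h
    | cons h _ _ ih => exact .head h ih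
  · intro h
    induction h using Relation.TransGen.head_induction_on with
    | single h => exact .single h
    | head h _ ih => exact .cons h trivial ih

/-- Cut the path at its intermediate visits to `k`: a segment up to the first, loops between
consecutive visits, a segment after the last. -/
theorem insert_iff {k : I} : PathVia r (insert k X) x y ↔ PathVia r X x y ∨
    ∃ v, PathVia r X x (v, k) ∧
      ∃ w, Relation.ReflTransGen (fun v w => PathVia r X (v, k) (w, k)) v w ∧
        PathVia r X (w, k) y := by
  constructor
  · intro h
    induction h with
    | single h => exact .inl (.single h)
    | @cons x z y h hz _ ih =>
      rcases hz with hz | hz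
      · obtain ⟨z, _⟩ := z
        obtain rfl : _ = k := hz
        -- The first step lands on `k`: either this is the only visit and there are no loops, or the
        -- segment to the next visit is one more loop.
        rcases ih with ih | ⟨v, h₁, w, h₂, h₃⟩
        · exact .inr ⟨z, .single h, z, .refl, ih⟩
        · exact .inr ⟨z, .single h, w, .head h₁ h₂, h₃⟩
      · rcases ih with ih | ⟨v, h₁, w, h₂, h₃⟩
        · exact .inl (.cons h hz ih)
        · exact .inr ⟨v, .cons h hz h₁, w, h₂, h₃⟩
  · have hX : X ⊆ insert k X := Set.subset_insert k X
    have hk : k ∈ insert k X := Set.mem_insert k X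
    rintro (h | ⟨v, h₁, w, h₂, h₃⟩)
    · exact h.mono hX
    · refine (h₁.mono hX).trans hk ?_
      clear h₁
      induction h₂ using Relation.ReflTransGen.head_induction_on with
      | refl => exact h₃.mono hX
      | head h _ ih => exact (h.mono hX).trans hk ih

end PathVia

/-- The relation on labelled states assembled from a matrix of relations. -/
def matrixRel {I : Type*} (F : I → I → EpRel.{u} Agent AtSen) (S : StateModel.{u} Agent AtSen)
    (x y : S.State × I) : Prop :=
  F x.2 y.2 S x.1 y.1

/-- Kleene's theorem: the entries of the transitive closure of a finite matrix of definable
relations are definable. -/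
theorem EpRel.IsPDL.transGen_matrix {I : Type*} [Finite I] {F : I → I → EpRel.{u} Agent AtSen}
    (hF : ∀ i j, (F i j).IsPDL) (i j : I) :
    EpRel.IsPDL (fun S s t => Relation.TransGen (matrixRel F S) (s, i) (t, j)) := by
  classical
  -- Induction on the set of labels allowed at intermediate nodes, for all entries at once.
  have key (X : Finset I) : ∀ i j,
      EpRel.IsPDL (fun S s t => PathVia (matrixRel F S) (X : Set I) (s, i) (t, j)) := by
    induction X using Finset.induction_on with
    | empty => simpa only [Finset.coe_empty, PathVia.empty_iff, matrixRel] using hF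
    | insert k X _ ih =>
      intro i j
      simp only [Finset.coe_insert, PathVia.insert_iff]
      exact (ih i j).union ((ih i k).comp ((ih k k).star.comp (ih k j)))
  have := Fintype.ofFinite I
  simpa only [Finset.coe_univ, PathVia.univ_iff] using key Finset.univ i j

-- Reduction of PDL along update products.

namespace ProgramModel

variable {M N : ProgramModel.{u} Agent AtSen}

/-- A finite program model with definable preconditions. -/
structure IsPDL (M : ProgramModel.{u} Agent AtSen) : Prop where
  finite : Finite M.Act
  pre (σ : M.Act) : (M.pre σ).IsPDL

/-- The epistemic proposition `[M, σ] P`. -/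
def afterAct (M : ProgramModel.{u} Agent AtSen) (σ : M.Act) (P : EpProp.{u} Agent AtSen) :
    EpProp.{u} Agent AtSen :=
  fun S => {s | ∀ h : s ∈ M.pre σ S, (⟨(s, σ), h⟩ : (product S M).State) ∈ P (product S M)}

/-- The relation induced on states by a relation on the update product, between fixed
actions. -/
def pullRel (M : ProgramModel.{u} Agent AtSen) (R : EpRel.{u} Agent AtSen) (σ τ : M.Act) :
    EpRel.{u} Agent AtSen :=
  fun S s t => ∃ (h : s ∈ M.pre σ S) (h' : t ∈ M.pre τ S),
    R (product S M) ⟨(s, σ), h⟩ ⟨(t, τ), h'⟩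

/-- Each edge certifies the preconditions at both its ends, so nonempty paths lift to the product.
An empty path certifies nothing, hence `TransGen` rather than `ReflTransGen`. -/
theorem transGen_pullRel_iff {R : EpRel.{u} Agent AtSen} {S : StateModel.{u} Agent AtSen}
    {s t : S.State} {σ τ : M.Act} :
    Relation.TransGen (matrixRel (M.pullRel R) S) (s, σ) (t, τ) ↔
      M.pullRel (fun S => Relation.TransGen (R S)) σ τ S s t := by
  constructor
  · have key (x y : S.State × M.Act) (h : Relation.TransGen (matrixRel (M.pullRel R) S) x y) :
        M.pullRel (fun S => Relation.TransGen (R S)) x.2 y.2 S x.1 y.1 := by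
      induction h with
      | single h =>
        obtain ⟨h, h', hR⟩ := h
        exact ⟨h, h', .single hR⟩
      | tail _ h ih =>
        obtain ⟨_, h', hR⟩ := h
        obtain ⟨h, _, hT⟩ := ih
        exact ⟨h, h', hT.tail hR⟩
    exact key (s, σ) (t, τ)
  · rintro ⟨h, h', hT⟩
    exact hT.lift Subtype.val fun x y hxy => ⟨x.2, y.2, hxy⟩

mutual

/-- Reduction of `[M, σ]` over sentences of propositional dynamic logic. -/
theorem IsPDL.afterAct_sentence (hM : M.IsPDL) : ∀ (φ : PDL.Sentence Agent AtSen) (σ : M.Act),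
    (M.afterAct σ (fun S => φ.sem S)).IsPDL
  | .true, σ => by
    obtain ⟨ψ, h⟩ := EpProp.IsPDL.true (Agent := Agent) (AtSen := AtSen)
    exact ⟨ψ, fun S s => Iff.trans (iff_of_true (fun _ => trivial) trivial) (h S s)⟩
  | .atom q, σ => by
    obtain ⟨ψ, h⟩ := ((hM.pre σ).and (EpProp.IsPDL.atom q).neg).neg
    refine ⟨ψ, fun S s => ?_⟩
    rw [← h]
    change (s ∈ M.pre σ S → s ∈ S.val q) ↔ ¬(s ∈ M.pre σ S ∧ ¬ s ∈ S.val q)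
    exact not_and_not_right.symm
  | .neg φ, σ => by
    -- A single action has at most one outcome, so `[M, σ]¬φ` amounts to `Pre σ → ¬[M, σ]φ`.
    obtain ⟨ψ, h⟩ := ((hM.pre σ).and (hM.afterAct_sentence φ σ)).neg
    refine ⟨ψ, fun S s => ?_⟩
    simp only [← h, afterAct, PDL.Sentence.sem, EpProp.neg, EpProp.and, Set.mem_compl_iff,
      Set.mem_inter_iff, Set.mem_ofPred_eq, not_and]
    exact forall_congr' fun hs => not_congr ⟨fun h _ => h, fun h => h hs⟩
  | .and φ χ, σ => by
    obtain ⟨ψ, h⟩ := (hM.afterAct_sentence φ σ).and (hM.afterAct_sentence χ σ)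
    exact ⟨ψ, fun S s => forall_and.trans (h S s)⟩
  | .box π φ, σ => by
    have := hM.finite
    have := Fintype.ofFinite M.Act
    -- Split by the action `τ` at which the run of `π` ends.
    obtain ⟨ψ, h⟩ := EpProp.IsPDL.forall_finset Finset.univ fun τ =>
      EpProp.IsPDL.boxRel (hM.pullRel_program π σ τ) (hM.afterAct_sentence φ τ)
    refine ⟨ψ, fun S s => ?_⟩
    rw [← h]
    constructor
    · rintro hs τ - t ⟨h₁, h₂, hst⟩ _
      exact hs h₁ _ hst
    · rintro hs h₁ ⟨⟨t, τ⟩, h₂⟩ hst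
      exact hs τ (Finset.mem_univ τ) t ⟨h₁, h₂, hst⟩ h₂

/-- Program transformation along an update product. -/
theorem IsPDL.pullRel_program (hM : M.IsPDL) : ∀ (π : PDL.Program Agent AtSen) (σ τ : M.Act),
    (M.pullRel (fun S => π.sem S) σ τ).IsPDL
  | .atom A, σ, τ => by
    obtain ⟨ρ, h⟩ := (EpRel.IsPDL.restrict (hM.pre σ) (hM.pre τ)
      (EpRel.IsPDL.atom A)).const_and (M.arrow A σ τ)
    refine ⟨ρ, fun S s t => ?_⟩
    rw [← h]
    simp only [pullRel, PDL.Program.sem, product, exists_prop]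
    tauto
  | .test φ, σ, τ => by
    obtain ⟨ρ, h⟩ := (EpRel.IsPDL.test
      ((hM.pre σ).and (hM.afterAct_sentence φ σ))).const_and (σ = τ)
    refine ⟨ρ, fun S s t => ?_⟩
    rw [← h]
    simp only [pullRel, PDL.Program.sem]
    constructor
    · rintro ⟨h₁, h₂, heq, hφ⟩
      obtain ⟨rfl, rfl⟩ := Prod.ext_iff.1 (Subtype.ext_iff.1 heq)
      exact ⟨rfl, rfl, h₁, fun _ => hφ⟩
    · rintro ⟨rfl, rfl, h₁, hφ⟩
      exact ⟨h₁, h₁, rfl, hφ h₁⟩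
  | .comp π ρ, σ, τ => by
    have := hM.finite
    have := Fintype.ofFinite M.Act
    obtain ⟨κ, h⟩ := EpRel.IsPDL.exists_finset Finset.univ fun υ =>
      (hM.pullRel_program π σ υ).comp (hM.pullRel_program ρ υ τ)
    refine ⟨κ, fun S s t => ?_⟩
    rw [← h]
    simp only [pullRel, PDL.Program.sem, Relation.Comp]
    constructor
    · rintro ⟨h₁, h₂, ⟨⟨v, υ⟩, h₃⟩, hπ, hρ⟩
      exact ⟨υ, Finset.mem_univ υ, v, ⟨h₁, h₃, hπ⟩, h₃, h₂, hρ⟩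
    · rintro ⟨υ, -, v, ⟨h₁, h₃, hπ⟩, _, h₂, hρ⟩
      exact ⟨h₁, h₂, _, hπ, hρ⟩
  | .union π ρ, σ, τ => by
    obtain ⟨κ, h⟩ := (hM.pullRel_program π σ τ).union (hM.pullRel_program ρ σ τ)
    refine ⟨κ, fun S s t => ?_⟩
    rw [← h]
    simp only [pullRel, PDL.Program.sem, exists_or]
  | .star π, σ, τ => by
    have := hM.finite
    -- The test restores the empty iteration, guarded by the precondition that a state of the
    -- product needs.
    obtain ⟨κ, h⟩ := ((EpRel.IsPDL.test (hM.pre σ)).const_and (σ = τ)).union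
      (EpRel.IsPDL.transGen_matrix (hM.pullRel_program π) σ τ)
    refine ⟨κ, fun S s t => ?_⟩
    rw [← h]
    simp only [transGen_pullRel_iff, pullRel, PDL.Program.sem]
    constructor
    · rintro ⟨h₁, h₂, hst⟩
      rcases Relation.reflTransGen_iff_eq_or_transGen.1 hst with heq | hst
      · obtain ⟨rfl, rfl⟩ := Prod.ext_iff.1 (Subtype.ext_iff.1 heq)
        exact .inl ⟨rfl, rfl, h₁⟩
      · exact .inr ⟨h₁, h₂, hst⟩
    · rintro (⟨rfl, rfl, h₁⟩ | ⟨h₁, h₂, hst⟩)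
      · exact ⟨h₁, h₁, .refl⟩
      · exact ⟨h₁, h₂, hst.to_reflTransGen⟩

end

theorem IsPDL.afterAct (hM : M.IsPDL) {P : EpProp.{u} Agent AtSen} (hP : P.IsPDL) (σ : M.Act) :
    (M.afterAct σ P).IsPDL := by
  obtain ⟨φ, hφ⟩ := hP
  obtain ⟨ψ, h⟩ := hM.afterAct_sentence φ σ
  exact ⟨ψ, fun S s => (forall_congr' fun _ => hφ _ _).trans (h S s)⟩

theorem IsPDL.after (hM : M.IsPDL) {P : EpProp.{u} Agent AtSen} (hP : P.IsPDL) :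
    (EpProp.after M.toUpdate P).IsPDL := by
  have := hM.finite
  obtain ⟨ψ, h⟩ := EpProp.IsPDL.forall_finset (Set.toFinite M.designated).toFinset
    (hM.afterAct hP)
  refine ⟨ψ, fun S s => ?_⟩
  rw [← h]
  constructor
  · intro hs σ hσ hpre
    exact hs ⟨(s, σ), hpre⟩ ⟨rfl, by simpa using hσ⟩
  · rintro hs ⟨⟨_, σ⟩, hpre⟩ ⟨rfl, hσ⟩
    exact hs σ (by simpa using hσ) hpre

theorem IsPDL.point (hM : M.IsPDL) (σ : M.Act) : (M.point σ).IsPDL :=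
  ⟨hM.finite, hM.pre⟩

theorem IsPDL.canAfter (hM : M.IsPDL) {P : EpProp.{u} Agent AtSen} (hP : P.IsPDL) :
    (EpProp.canAfter M.toUpdate P).IsPDL := by
  obtain ⟨ψ, h⟩ := (hM.after hP.neg).neg
  exact ⟨ψ, fun S s => by simp [← h, EpProp.canAfter, EpProp.after, EpProp.neg]⟩

theorem IsPDL.skip : (skip : ProgramModel.{u} Agent AtSen).IsPDL :=
  ⟨inferInstanceAs (Finite Unit), fun _ => .true⟩

theorem IsPDL.crash : (crash : ProgramModel.{u} Agent AtSen).IsPDL :=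
  ⟨inferInstanceAs (Finite Empty), fun _ => .true⟩

theorem IsPDL.union (hM : M.IsPDL) (hN : N.IsPDL) : (M.union N).IsPDL where
  finite := by
    have := hM.finite
    have := hN.finite
    exact inferInstanceAs (Finite (M.Act ⊕ N.Act))
  pre
    | .inl σ => hM.pre σ
    | .inr σ => hN.pre σ

/-- The composite's preconditions themselves contain a dynamic modality, so the reduction is needed
here too. -/
theorem IsPDL.comp (hM : M.IsPDL) (hN : N.IsPDL) : (M.comp N).IsPDL where
  finite := by
    have := hM.finite
    have := hN.finite
    exact inferInstanceAs (Finite (M.Act × N.Act))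
  pre x := (hM.point x.1).canAfter (hN.pre x.2)

end ProgramModel

-- Mutual induction over sentences and programs.

mutual

theorem Sentence.isPDL_sem {Sig : ActionSignature Agent} :
    ∀ φ : Sentence Sig AtSen, (φ.sem : EpProp.{u} Agent AtSen).IsPDL
  | .true => by rw [Sentence.sem]; exact .true
  | .atom q => by rw [Sentence.sem]; exact .atom q
  | .neg φ => by rw [Sentence.sem]; exact φ.isPDL_sem.neg
  | .and φ ψ => by rw [Sentence.sem]; exact φ.isPDL_sem.and ψ.isPDL_sem
  | .box A φ => by rw [Sentence.sem]; exact φ.isPDL_sem.box A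
  | .boxStar B φ => by rw [Sentence.sem]; exact φ.isPDL_sem.boxStar B
  | .after π φ => by rw [Sentence.sem]; exact π.isPDL_sem.after φ.isPDL_sem

theorem Program.isPDL_sem {Sig : ActionSignature Agent} :
    ∀ π : Program Sig AtSen, (π.sem : ProgramModel.{u} Agent AtSen).IsPDL
  | .skip => by rw [Program.sem]; exact .skip
  | .crash => by rw [Program.sem]; exact .crash
  | .basic σ ψ => by
    rw [Program.sem]
    exact ⟨Finite.of_equiv _ Sig.enum, fun τ => (ψ (Sig.enum.symm τ)).isPDL_sem⟩
  | .union π ρ => by rw [Program.sem]; exact π.isPDL_sem.union ρ.isPDL_sem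
  | .comp π ρ => by rw [Program.sem]; exact π.isPDL_sem.comp ρ.isPDL_sem

end

end DEL

theorem mainTheorem3 {Agent : Type a} {AtSen : Type p}
    (Sig : DEL.ActionSignature Agent) (φ : DEL.Sentence Sig AtSen) :
    ∃ ψ : DEL.PDL.Sentence Agent AtSen,
      ∀ (S : DEL.StateModel.{u} Agent AtSen) (s : S.State), s ∈ φ.sem S ↔ s ∈ ψ.sem S :=
  φ.isPDL_sem
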